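/- Let $p$ be a prime, $\mathbb K$ a field of characteristic $p$, $n>1$ an integer and $\kappa\in\mathbb F_p^\times\subset\mathbb K$. Let $k=k(\kappa)$ be the integer with $0<k<p$ and $\kappa k\equiv-1\pmod p$, and put $d(\kappa)=\lfloor nk/p\rfloor$; so $k(-\kappa)=p-k$ and $d(-\kappa)=\lfloor n(p-k)/p\rfloor$. Write $(t;\kappa)_m=\prod_{i=1}^m(t-(i-1)\kappa)$ and $z=(z_1,\dots,z_n)$. For $1\le a\le n$ define the polynomials $$Q_a(t,z;\kappa)=\prod_{b=1}^n(t-z_b;\kappa)_{k}\cdot\frac1{t-z_a}\prod_{j=1}^{a-1}\frac{t-z_j+1}{t-z_j}\in\mathbb K[t,z_1,\dots,z_n]$$ and define $Q^i_a(z;\kappa)\in\mathbb K[z_1,\dots,z_n]$ by the expansion $Q_a(t,z;\kappa)=\sum_{i\ge0}Q^i_a(z;\kappa)\,(t;\kappa)_i$. The same definitions with $\kappa$ replaced by $-\kappa$ (hence $k$ by $p-k$) give $Q^i_a(z;-\kappa)$. Let $L$ be the two-dimensional space with basis $v_1,v_2$; for $I\subset\{1,\dots,n\}$ let $v_I\in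 L^{\otimes n}$ be the tensor product of basis vectors with $v_2$ in the places belonging to $I$ and $v_1$ in the other places. Let $S$ be the Shapovalov form on $L^{\otimes n}$, the symmetric bilinear form with $S(v_I,v_J)=\delta_{I,J}$, extended bilinearly to polynomial coefficients. Put $Q^i(z;\pm\kappa)=\sum_{a=1}^nQ^i_a(z;\pm\kappa)\,v_{\{a\}}$; the vectors $Q^{\ell p-1}(z;\kappa)$, $1\le\ell\le d(\kappa)$, are called the $p$-hypergeometric solutions (of the qKZ equations) with step $\kappa$. **Theorem 1.3.** Let $p>n$ and $0<d(\kappa)<n-1$. Then for all $\ell\in\{1,\dots,d(\kappa)\}$ and $m\in\{1,\dots,d(-\kappa)\}$, $$S\big(Q^{mp-1}(-z;-\kappa),\,Q^{\ell p-1}(z;\kappa)\big)=\sum_{a=1}^nQ^{mp-1}_a(-z;-\kappa)\,Q^{\ell p-1}_a(z;\kappa)=0$$ in $\mathbb K[z_1,\dots,z_n]$. In words, the $p$-hypergeometric solutions with steps $\kappa$ and $-\kappa$ are orthogonal. -/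

import Mathlib

open Polynomial
open scoped TensorProduct

noncomputable section

namespace QKZ

/-! ### Pochhammer polynomials -/

/-- The Pochhammer product `(x; c)_m = ∏_{i=1}^{m} (x - (i-1) c)` in a commutative ring. -/
def poch {A : Type*} [CommRing A] (x c : A) (m : ℕ) : A :=
  ∏ i ∈ Finset.range m, (x - (i : A) * c)

theorem poch_X_monic_natDegree {A : Type*} [CommRing A] [Nontrivial A] (c : A) (m : ℕ) :
    (poch (X : A[X]) (C c) m).Monic ∧ (poch (X : A[X]) (C c) m).natDegree = m := by
  have h : poch (X : A[X]) (C c) m = ∏ i ∈ Finset.range m, (X - C ((i : A) * c)) := by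
    simp [poch]
  rw [h]
  refine ⟨monic_prod_of_monic _ _ fun i _ => monic_X_sub_C _, ?_⟩
  rw [natDegree_prod_of_monic _ _ fun i _ => monic_X_sub_C _]
  simp only [natDegree_X_sub_C, Finset.sum_const, Finset.card_range, smul_eq_mul, mul_one]

/-- The sequence of polynomials `(t; c)_m`, `m ≥ 0`, in `A[t]`; the `m`-th has degree `m`. -/
def pochSeq {A : Type*} [CommRing A] [Nontrivial A] (c : A) : Polynomial.Sequence A where
  elems' m := poch (X : A[X]) (C c) m
  degree_eq' m := by
    obtain ⟨h1, h2⟩ := poch_X_monic_natDegree c m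
    rw [degree_eq_natDegree h1.ne_zero, h2]

/-- The `A`-basis `(t; c)_m`, `m ≥ 0`, of `A[t]`. -/
def pochBasis {A : Type*} [CommRing A] [IsDomain A] (c : A) : Module.Basis ℕ A A[X] :=
  (pochSeq c).basis fun m => by
    have h : (pochSeq c m).leadingCoeff = 1 := (poch_X_monic_natDegree c m).1
    rw [h]; exact isUnit_one

theorem pochBasis_apply {A : Type*} [CommRing A] [IsDomain A] (c : A) (m : ℕ) :
    pochBasis c m = poch (X : A[X]) (C c) m :=
  (pochSeq c).basis_eq_self _ m

/-! ### The integers `k` and `d(κ)` -/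

section Step

variable {p : ℕ} [Fact p.Prime]

/-- The integer `k` with `0 < k < p` and `κ k ≡ -1 (mod p)`; see `kOf_spec`, `kOf_unique`. -/
def kOf (κ : (ZMod p)ˣ) : ℕ := ((-κ⁻¹ : (ZMod p)ˣ) : ZMod p).val

theorem kOf_spec (κ : (ZMod p)ˣ) :
    0 < kOf κ ∧ kOf κ < p ∧ (κ : ZMod p) * (kOf κ : ZMod p) = -1 := by
  refine ⟨?_, ZMod.val_lt _, ?_⟩
  · rw [Nat.pos_iff_ne_zero, kOf, Ne, ZMod.val_eq_zero]
    exact Units.ne_zero _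
  · rw [kOf, ZMod.natCast_zmod_val, ← Units.val_mul]
    simp

theorem kOf_unique (κ : (ZMod p)ˣ) (k : ℕ) (hk : k < p)
    (h : (κ : ZMod p) * (k : ZMod p) = -1) : k = kOf κ := by
  have h2 := (kOf_spec κ).2.2
  rw [← h] at h2
  have h3 : (kOf κ : ZMod p) = (k : ZMod p) := κ.isUnit.mul_left_cancel h2
  have h4 := congrArg ZMod.val h3
  rwa [ZMod.val_natCast_of_lt (kOf_spec κ).2.1, ZMod.val_natCast_of_lt hk, eq_comm] at h4

/-- `d(κ) = [n k / p]`, the number of `p`-hypergeometric solutions with step `κ`. -/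
def dOf (n : ℕ) (κ : (ZMod p)ˣ) : ℕ := n * kOf κ / p

end Step

/-! ### Master polynomial, weight functions and `p`-hypergeometric solutions

`MvPolynomial (Fin n) K` is `K[z₁, …, zₙ]`, and polynomials over it are polynomials in `t`. -/

section Solutions

variable {p : ℕ} [Fact p.Prime] (K : Type*) [Field K] [CharP K p] {n : ℕ}

/-- The step `κ ∈ 𝔽_p^×`, seen as a constant of `K[z]`. -/
def step (n : ℕ) (κ : (ZMod p)ˣ) : MvPolynomial (Fin n) K :=
  MvPolynomial.C (ZMod.castHom (dvd_refl p) K (κ : ZMod p))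

/-- `t - z_j` as an element of `K[z][t]`. -/
def tz (j : Fin n) : (MvPolynomial (Fin n) K)[X] := X - C (MvPolynomial.X j)

/-- The master polynomial `Φ(t, z; κ) = ∏_a (t - z_a; κ)_k`. -/
def master (n : ℕ) (κ : (ZMod p)ˣ) : (MvPolynomial (Fin n) K)[X] :=
  ∏ a : Fin n, poch (tz K a) (C (step K n κ)) (kOf κ)

/-- The weight function `η_a(t, z) = 1/(t - z_a) ∏_{j < a} (t - z_j + 1)/(t - z_j)`, a rational
function. -/
def eta (a : Fin n) : FractionRing (MvPolynomial (Fin n) K)[X] :=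
  1 / algebraMap _ _ (tz K a) *
    ∏ j ∈ Finset.univ.filter (· < a), algebraMap _ _ (tz K j + 1) / algebraMap _ _ (tz K j)

/-- The polynomial `Q_a(t, z; κ) = Φ(t, z; κ) η_a(t, z)`, written out as a product of Pochhammer
polynomials; `algebraMap_Qpoly` shows that it is `Φ η_a`. -/
def Qpoly (κ : (ZMod p)ˣ) (a : Fin n) : (MvPolynomial (Fin n) K)[X] :=
  (∏ j ∈ Finset.univ.filter (· < a),
      poch (tz K j - C (step K n κ)) (C (step K n κ)) (kOf κ)) *
    poch (tz K a - C (step K n κ)) (C (step K n κ)) (kOf κ - 1) *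
    ∏ j ∈ Finset.univ.filter (a < ·), poch (tz K j) (C (step K n κ)) (kOf κ)

theorem poch_succ_left {A : Type*} [CommRing A] (x c : A) (m : ℕ) :
    poch x c (m + 1) = x * poch (x - c) c m := by
  rw [poch, Finset.prod_range_succ', poch, mul_comm]
  congr 1
  · simp
  · refine Finset.prod_congr rfl fun i _ => ?_
    push_cast; ring

theorem poch_succ_right {A : Type*} [CommRing A] (x c : A) (m : ℕ) :
    poch x c (m + 1) = poch x c m * (x - (m : A) * c) := by
  rw [poch, Finset.prod_range_succ, poch]

theorem step_mul_kOf (κ : (ZMod p)ˣ) : (kOf κ : MvPolynomial (Fin n) K) * step K n κ = -1 := by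
  have h := congrArg (ZMod.castHom (dvd_refl p) K) (kOf_spec κ).2.2
  rw [map_mul, map_natCast, map_neg, map_one] at h
  have h2 := congrArg (MvPolynomial.C (σ := Fin n)) h
  rw [map_mul, map_natCast, map_neg, map_one] at h2
  rw [mul_comm]; exact h2

/-- `Q_a(t, z; κ) = Φ(t, z; κ) η_a(t, z)`. -/
theorem algebraMap_Qpoly (κ : (ZMod p)ˣ) (a : Fin n) :
    algebraMap _ (FractionRing (MvPolynomial (Fin n) K)[X]) (Qpoly K κ a) =
      algebraMap _ _ (master K n κ) * eta K a := by
  have hne (j : Fin n) :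
      algebraMap _ (FractionRing (MvPolynomial (Fin n) K)[X]) (tz K j) ≠ 0 := by
    rw [Ne, FaithfulSMul.algebraMap_eq_zero_iff]
    exact X_sub_C_ne_zero _
  obtain ⟨m, hm⟩ : ∃ m, kOf κ = m + 1 := Nat.exists_eq_succ_of_ne_zero (kOf_spec κ).1.ne'
  have h1 (j : Fin n) : poch (tz K j) (C (step K n κ)) (kOf κ) =
      tz K j * poch (tz K j - C (step K n κ)) (C (step K n κ)) (kOf κ - 1) := by
    rw [hm, poch_succ_left]; rfl
  have h2 (j : Fin n) : tz K j * poch (tz K j - C (step K n κ)) (C (step K n κ)) (kOf κ) =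
      poch (tz K j) (C (step K n κ)) (kOf κ) * (tz K j + 1) := by
    have h3 : ((kOf κ : ℕ) : (MvPolynomial (Fin n) K)[X]) * C (step K n κ) = -1 := by
      have := congrArg C (step_mul_kOf K (n := n) κ)
      rwa [map_mul, map_natCast, map_neg, map_one] at this
    rw [← poch_succ_left, poch_succ_right, h3, sub_neg_eq_add]
  have hsplit (f : Fin n → FractionRing (MvPolynomial (Fin n) K)[X]) :
      ∏ j, f j = (∏ j ∈ Finset.univ.filter (· < a), f j) * f a *
        ∏ j ∈ Finset.univ.filter (a < ·), f j := by
    rw [← Finset.prod_filter_mul_prod_filter_not Finset.univ (· < a), mul_assoc]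
    congr 1
    have : Finset.univ.filter (fun j => ¬ j < a) =
        insert a (Finset.univ.filter (a < ·)) := by
      ext j; simp [le_iff_eq_or_lt, eq_comm]
    rw [this, Finset.prod_insert (by simp)]
  rw [master, eta, Qpoly]
  simp only [map_mul, map_prod]
  rw [hsplit, h1 a, map_mul]
  have h4 : (∏ j ∈ Finset.univ.filter (· < a),
      algebraMap _ (FractionRing (MvPolynomial (Fin n) K)[X])
        (poch (tz K j - C (step K n κ)) (C (step K n κ)) (kOf κ))) =
      (∏ j ∈ Finset.univ.filter (· < a),
        algebraMap _ (FractionRing (MvPolynomial (Fin n) K)[X])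
          (poch (tz K j) (C (step K n κ)) (kOf κ))) *
      ∏ j ∈ Finset.univ.filter (· < a),
        algebraMap _ (FractionRing (MvPolynomial (Fin n) K)[X]) (tz K j + 1) /
          algebraMap _ (FractionRing (MvPolynomial (Fin n) K)[X]) (tz K j) := by
    rw [← Finset.prod_mul_distrib]
    refine Finset.prod_congr rfl fun j _ => ?_
    rw [mul_div_assoc', eq_div_iff (hne j), ← map_mul, ← map_mul, ← h2, mul_comm]
  rw [h4]
  have := hne a
  field_simp

/-- `Q^i_a(z; κ) ∈ K[z]`, the coefficient of `(t; κ)_i` in the expansion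
`Q_a(t, z; κ) = ∑_i Q^i_a(z; κ) (t; κ)_i`. -/
def Qcoeff (κ : (ZMod p)ˣ) (i : ℕ) (a : Fin n) : MvPolynomial (Fin n) K :=
  (pochBasis (step K n κ)).repr (Qpoly K κ a) i

theorem Qpoly_eq_sum (κ : (ZMod p)ˣ) (a : Fin n) :
    Qpoly K κ a = ((pochBasis (step K n κ)).repr (Qpoly K κ a)).sum fun i _ =>
      C (Qcoeff K κ i a) * poch X (C (step K n κ)) i := by
  conv_lhs => rw [← (pochBasis (step K n κ)).linearCombination_repr (Qpoly K κ a),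
    Finsupp.linearCombination_apply]
  simp only [pochBasis_apply, smul_eq_C_mul, Qcoeff, Finsupp.sum]

end Solutions

/-! ### The space `L^{⊗ n}` and the Shapovalov form -/

section Shapovalov

variable (R : Type*) [CommRing R] (n : ℕ)

/-- `L^{⊗ n}` with scalars `R`, where `L` is free with basis `v₁, v₂` (indexed by `0, 1`). -/
abbrev Tens : Type _ := ⨂[R] _ : Fin n, (Fin 2 → R)

/-- The basis of the vectors `v_{i₁} ⊗ ⋯ ⊗ v_{iₙ}` of `L^{⊗ n}`, that is, of the `v_I`. -/
def tensBasis : Module.Basis (Fin n → Fin 2) R (Tens R n) :=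
  Basis.piTensorProduct fun _ => Pi.basisFun R (Fin 2)

/-- The Shapovalov form: the symmetric bilinear form with `S(v_I, v_J) = δ_{I,J}`. -/
def shapovalov : LinearMap.BilinForm R (Tens R n) := (tensBasis R n).toDual

/-- The vector `v^{(a)} = v₁ ⊗ ⋯ ⊗ v₂ ⊗ ⋯ ⊗ v₁` with `v₂` at the `a`-th place. -/
def vOne (a : Fin n) : Tens R n :=
  PiTensorProduct.tprod R fun j => (Pi.single (if j = a then 1 else 0) 1 : Fin 2 → R)

theorem vOne_eq_tensBasis (a : Fin n) :
    vOne R n a = tensBasis R n fun j => if j = a then 1 else 0 := by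
  simp [vOne, tensBasis, Basis.piTensorProduct_apply]

end Shapovalov

section Vectors

variable {p : ℕ} [Fact p.Prime] (K : Type*) [Field K] [CharP K p] (n : ℕ)

/-- The substitution `z ↦ -z` in `K[z]`. -/
def negZ : MvPolynomial (Fin n) K →ₐ[K] MvPolynomial (Fin n) K :=
  MvPolynomial.aeval fun i => -MvPolynomial.X i

/-- The `L^{⊗ n}[n-2]`-valued polynomial `Q^i(z; κ) = ∑_a Q^i_a(z; κ) v^{(a)}`. -/
def Qvec (κ : (ZMod p)ˣ) (i : ℕ) : Tens (MvPolynomial (Fin n) K) n :=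
  ∑ a : Fin n, Qcoeff K κ i a • vOne _ n a

/-- The `L^{⊗ n}[n-2]`-valued polynomial `Q^i(-z; κ) = ∑_a Q^i_a(-z; κ) v^{(a)}`. -/
def QvecNeg (κ : (ZMod p)ˣ) (i : ℕ) : Tens (MvPolynomial (Fin n) K) n :=
  ∑ a : Fin n, negZ K n (Qcoeff K κ i a) • vOne _ n a

end Vectors

end QKZ

end

namespace QKZ

open Polynomial

/-! ### Pochhammer products and their discrete derivative. -/

section Pochhammer

variable {A B : Type*} [CommRing A] [CommRing B]

/-! Summing a polynomial in t over its translates by 𝔽_p kills (t; κ)_i unless p ∣ i + 1, since it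
is then a multiple of a discrete derivative. It sends (t; κ)_{lp+p-1} to T^l D, where T = (t; κ)_p
is translation invariant and D ≠ 0 does not depend on l. So the coefficients of index -1 modulo p
can be read off from the shift sum (`exists_shiftSum_eq_comp`). It therefore suffices that ∑_a
Q_a(t, z; κ) Q_a(u, -z; -κ), summed over the translates of t and of u independently, vanishes in
K[z][t][u] (`sum_repr_mul_repr_eq_zero`).

By `telescoping`, t + u + 1 times the untranslated sum is Φ(t-κ, z; κ) Φ(u+κ, -z; -κ) - Φ(t, z; κ)
Φ(u, -z; -κ). Translating t by s and u by s' turns the factor into t + u + s + s' + 1, which is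
constant on each antidiagonal s + s' = q, and along it the right-hand sides cancel cyclically. The
factor is nonzero in a domain, so each antidiagonal contributes zero
(`sum_sum_eq_zero_of_antidiagonal`). -/

theorem map_poch (f : A →+* B) (x c : A) (m : ℕ) : f (poch x c m) = poch (f x) (f c) m := by
  simp [poch]

theorem poch_add (x c : A) (m l : ℕ) :
    poch x c (m + l) = poch x c m * poch (x - m * c) c l := by
  simp only [poch, Finset.prod_range_add]
  congr 1
  refine Finset.prod_congr rfl fun i _ => ?_
  push_cast; ring

/-- The discrete derivative of a Pochhammer product. -/
theorem poch_shift_sub (x c : A) (m : ℕ) :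
    poch (x + c) c (m + 1) - poch x c (m + 1) = ((m + 1 : ℕ) : A) * c * poch x c m := by
  rw [poch_succ_left, poch_succ_right, add_sub_cancel_right]
  push_cast; ring

end Pochhammer

/-! ### Sums over translates by the prime field. -/

section ShiftSum

variable {p : ℕ} [Fact p.Prime] {R : Type*} [CommRing R] (φ : ZMod p →+* R)

/-- The sum of the translates of a polynomial by the elements of the prime field. -/
noncomputable def shiftSum : R[X] →ₗ[R] R[X] := ∑ s : ZMod p, taylor (φ s)

theorem shiftSum_apply (f : R[X]) : shiftSum φ f = ∑ s : ZMod p, taylor (φ s) f := by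
  simp [shiftSum]

theorem shiftSum_taylor (r : ZMod p) (f : R[X]) :
    shiftSum φ (taylor (φ r) f) = shiftSum φ f := by
  simp only [shiftSum_apply, taylor_taylor, ← map_add]
  exact Fintype.sum_equiv (Equiv.addRight r) _ _ fun s => by simp [add_comm]

theorem taylor_poch_X (r c : R) (m : ℕ) :
    taylor r (poch X (C c) m) = poch (X + C r) (C c) m := by
  have := map_poch (taylorAlgHom r : R[X] →+* R[X]) X (C c) m
  simpa using this

theorem natCast_eq_zero_of_ringHom_zmod {p : ℕ} {R : Type*} [CommRing R] (φ : ZMod p →+* R) :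
    (p : R) = 0 := by
  rw [← map_natCast φ p, ZMod.natCast_self, map_zero]

/-- The multiples iκ with 0 ≤ i < p run once through 𝔽_p; in particular the product does not depend
on κ. -/
theorem poch_prime_eq_prod (κ : (ZMod p)ˣ) :
    poch (X : R[X]) (C (φ κ)) p = ∏ s : ZMod p, (X - C (φ s)) := by
  rw [poch]
  refine Finset.prod_bij' (fun i _ => (i : ZMod p) * κ) (fun s _ => (s * (κ⁻¹ : (ZMod p)ˣ)).val)
    (by simp) (fun s _ => Finset.mem_range.2 (ZMod.val_lt _)) ?_ ?_ ?_
  · intro i hi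
    rw [Units.mul_inv_cancel_right, ZMod.val_natCast_of_lt (Finset.mem_range.1 hi)]
  · intro s _
    rw [ZMod.natCast_zmod_val, Units.inv_mul_cancel_right]
  · intro i _
    simp

theorem taylor_poch_prime (κ : (ZMod p)ˣ) (s : ZMod p) :
    taylor (φ s) (poch X (C (φ κ)) p) = poch X (C (φ κ)) p := by
  rw [poch_prime_eq_prod, ← taylorAlgHom_apply, map_prod]
  refine Fintype.prod_equiv (Equiv.subRight s) _ _ fun a => ?_
  simp
  ring

/-- Up to the unit (i + 1)κ, the polynomial (X; κ)_i is the difference of a translate of (X;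
κ)_{i+1} and itself, and shift sums do not see translations. -/
theorem shiftSum_poch_of_not_dvd [IsDomain R] (κ : (ZMod p)ˣ) {i : ℕ} (hi : ¬ p ∣ i + 1) :
    shiftSum φ (poch X (C (φ κ)) i) = 0 := by
  have h := congrArg (shiftSum φ) (poch_shift_sub (X : R[X]) (C (φ κ)) i)
  rw [← taylor_poch_X, map_sub, shiftSum_taylor, sub_self] at h
  have hne : ((i + 1 : ℕ) : R) * φ κ ≠ 0 := by
    rw [← map_natCast φ, ← map_mul, Ne, map_eq_zero, mul_eq_zero, not_or]
    exact ⟨fun h0 => hi ((ZMod.natCast_eq_zero_iff _ _).1 h0), κ.ne_zero⟩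
  have h2 : ((i + 1 : ℕ) : R[X]) * C (φ κ) * poch X (C (φ κ)) i =
      (((i + 1 : ℕ) : R) * φ κ) • poch X (C (φ κ)) i := by
    rw [smul_eq_C_mul, C_mul, C_eq_natCast]
  rw [h2, map_smul] at h
  exact (smul_eq_zero.1 h.symm).resolve_left hne

/-- Since p = 0 in `R`, splitting off the first p factors leaves the argument of the rest unshifted,
and the split factor is translation invariant. -/
theorem shiftSum_poch_mul_prime (κ : (ZMod p)ˣ) (l : ℕ) :
    shiftSum φ (poch X (C (φ κ)) (l * p + (p - 1))) =
      poch X (C (φ κ)) p ^ l * shiftSum φ (poch X (C (φ κ)) (p - 1)) := by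
  induction l with
  | zero => simp
  | succ l ih =>
    have h : (p : R[X]) = 0 := by
      rw [← C_eq_natCast, natCast_eq_zero_of_ringHom_zmod φ, C_0]
    rw [show (l + 1) * p + (p - 1) = p + (l * p + (p - 1)) by ring, poch_add, h, zero_mul,
      sub_zero, shiftSum_apply]
    simp only [taylor_mul, taylor_poch_prime]
    rw [← Finset.mul_sum, ← shiftSum_apply, ih]
    ring

theorem shiftSum_poch_pred_ne_zero [IsDomain R] (κ : (ZMod p)ˣ) :
    shiftSum φ (poch X (C (φ κ)) (p - 1)) ≠ 0 := by
  have hp : p.Prime := Fact.out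
  intro h0
  have h := congrArg (eval 0) h0
  rw [shiftSum_apply, eval_finsetSum, eval_zero] at h
  have h1 (s : ZMod p) : eval 0 (taylor (φ s) (poch X (C (φ κ)) (p - 1))) =
      φ (poch s κ (p - 1)) := by
    rw [taylor_poch_X, ← coe_evalRingHom, map_poch, map_poch]
    simp
  simp only [h1, ← map_sum, map_eq_zero] at h
  -- The zeros of (s; κ)_{p-1} in 𝔽_p are 0, κ, …, (p-2)κ, that is, every element except (p-1)κ =
  -- -κ.
  rw [Finset.sum_eq_single (-κ : ZMod p)] at h
  · rw [poch, Finset.prod_eq_zero_iff] at h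
    obtain ⟨i, hi, h⟩ := h
    have h2 : ((i + 1 : ℕ) : ZMod p) * κ = 0 := by
      push_cast; linear_combination -h
    have h3 := (mul_eq_zero.1 h2).resolve_right κ.ne_zero
    rw [ZMod.natCast_eq_zero_iff] at h3
    have := Nat.le_of_dvd (by omega) h3
    have := Finset.mem_range.1 hi
    omega
  · intro s _ hs
    rw [poch, Finset.prod_eq_zero_iff]
    have hs' : ((s * (κ⁻¹ : (ZMod p)ˣ)).val : ZMod p) * κ = s := by
      rw [ZMod.natCast_zmod_val, Units.inv_mul_cancel_right]
    refine ⟨(s * (κ⁻¹ : (ZMod p)ˣ)).val, ?_, by rw [hs', sub_self]⟩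
    rw [Finset.mem_range]
    by_contra hlt
    have h4 : (s * (κ⁻¹ : (ZMod p)ˣ)).val = p - 1 := by
      have := ZMod.val_lt (s * (κ⁻¹ : (ZMod p)ˣ) : ZMod p)
      omega
    rw [h4, Nat.cast_pred hp.pos, ZMod.natCast_self] at hs'
    exact hs (by rw [← hs']; ring)
  · simp

/-- The shift sum of `f` is, up to a fixed factor, a polynomial in `(X; φ κ)_p` whose coefficients
are the coefficients of `f` at the Pochhammer polynomials of index `-1` modulo `p`. -/
theorem exists_shiftSum_eq_comp [IsDomain R] (κ : (ZMod p)ˣ) (f : R[X]) :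
    ∃ g : R[X], shiftSum φ f =
        g.comp (poch X (C (φ κ)) p) * shiftSum φ (poch X (C (φ κ)) (p - 1)) ∧
      ∀ l, g.coeff l = (pochBasis (φ κ)).repr f (l * p + (p - 1)) := by
  have hp : p.Prime := Fact.out
  have hdecomp (i : ℕ) (hi : p ∣ i + 1) : ∃ l, i = l * p + (p - 1) := by
    obtain ⟨l, hl⟩ := hi
    cases l with
    | zero => omega
    | succ l =>
      refine ⟨l, ?_⟩
      have : p * (l + 1) = l * p + p := by ring
      have := hp.pos
      omega
  have hdvd (l : ℕ) : p ∣ l * p + (p - 1) + 1 :=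
    ⟨l + 1, by have := hp.pos; rw [mul_add, mul_comm p l]; omega⟩
  have hdiv (l : ℕ) : (l * p + (p - 1)) / p = l := by
    rw [mul_comm, Nat.mul_add_div hp.pos, Nat.div_eq_of_lt (Nat.sub_lt hp.pos one_pos), add_zero]
  -- For i = lp + p - 1 the quotient `i / p` is l, so `G` records exactly the surviving
  -- coefficients. Both claims are linear in f and are checked on the basis.
  let G : R[X] →ₗ[R] R[X] := (pochBasis (φ κ)).constr R fun i =>
    if p ∣ i + 1 then X ^ (i / p) else 0
  have hG (i : ℕ) : G (pochBasis (φ κ) i) = if p ∣ i + 1 then X ^ (i / p) else 0 :=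
    (pochBasis (φ κ)).constr_basis R _ i
  refine ⟨G f, ?_, fun l => ?_⟩
  · have : shiftSum φ = (LinearMap.mulRight R (shiftSum φ (poch X (C (φ κ)) (p - 1)))) ∘ₗ
        (aeval (poch (X : R[X]) (C (φ κ)) p)).toLinearMap ∘ₗ G := by
      refine (pochBasis (φ κ)).ext fun i => ?_
      simp only [LinearMap.comp_apply, hG]
      rw [pochBasis_apply]
      split_ifs with hi
      · obtain ⟨l, rfl⟩ := hdecomp i hi
        rw [hdiv, shiftSum_poch_mul_prime]
        simp
      · rw [shiftSum_poch_of_not_dvd φ κ hi]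
        simp
    simpa [comp, aeval_def] using congrArg (fun F => F f) this
  · have : lcoeff R l ∘ₗ G = (pochBasis (φ κ)).coord (l * p + (p - 1)) := by
      refine (pochBasis (φ κ)).ext fun i => ?_
      simp only [LinearMap.comp_apply, hG, Module.Basis.coord_apply, Module.Basis.repr_self,
        lcoeff_apply]
      by_cases hi : p ∣ i + 1
      · obtain ⟨l', rfl⟩ := hdecomp i hi
        rw [if_pos hi, hdiv, coeff_X_pow, Finsupp.single_apply]
        refine if_congr ⟨fun h => by rw [h], fun h => ?_⟩ rfl rfl
        rw [← hdiv l', ← hdiv l, h]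
      · rw [if_neg hi, coeff_zero, Finsupp.single_eq_of_ne]
        rintro rfl
        exact hi (hdvd l)
    exact congrArg (fun F => F f) this

/-- If the shift sums of `f a` and `h a` are orthogonal as polynomials in independent variables,
then so are the coefficients of `f a` and `h a` at Pochhammer polynomials of index `-1` modulo `p`.
The coefficients of `h a` may be transformed by a ring endomorphism `σ` fixing the prime field. -/
theorem sum_repr_mul_repr_eq_zero [IsDomain R] (κ ν : (ZMod p)ˣ) (σ : R →+* R) {ι : Type*}
    (S : Finset ι) (f h : ι → R[X])
    (H : ∑ a ∈ S, C (shiftSum φ (f a)) *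
      ((shiftSum φ (h a)).map σ).map (C : R →+* R[X]) = 0) (l m : ℕ) :
    ∑ a ∈ S, σ ((pochBasis (φ ν)).repr (h a) (m * p + (p - 1))) *
      (pochBasis (φ κ)).repr (f a) (l * p + (p - 1)) = 0 := by
  have hp : p.Prime := Fact.out
  have hσ (s : ZMod p) : σ (φ s) = φ s := RingHom.congr_fun (RingHom.ext_zmod (σ.comp φ) φ) s
  choose f' hf hfc using fun a => exists_shiftSum_eq_comp φ κ (f a)
  choose h' hh hhc using fun a => exists_shiftSum_eq_comp φ ν (h a)
  -- Substituting a nonconstant polynomial is injective over a domain. This is used over `R[X]` to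
  -- separate the variable of h, then over `R` for that of f.
  have hcomp {A : Type _} [CommRing A] [IsDomain A] (c : A) (g : A[X])
      (hg : g.comp (poch X (C c) p) = 0) : g = 0 := by
    rcases comp_eq_zero_iff.1 hg with hg | ⟨_, hg⟩
    · exact hg
    · have hd := (poch_X_monic_natDegree c p).2
      rw [hg, natDegree_C] at hd
      exact absurd hd.symm hp.ne_zero
  have hpoch : (((shiftSum φ (poch X (C (φ ν)) (p - 1))).map σ).map (C : R →+* R[X])) =
      (shiftSum φ (poch X (C (φ ν)) (p - 1))).map (C : R →+* R[X]) := by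
    congr 1
    rw [shiftSum_apply, Polynomial.map_sum]
    refine Finset.sum_congr rfl fun s _ => ?_
    rw [taylor_poch_X, ← coe_mapRingHom, map_poch]
    simp [hσ]
  have hP : ((poch X (C (φ ν)) p).map σ).map (C : R →+* R[X]) = poch X (C (C (φ ν))) p := by
    rw [← coe_mapRingHom, ← coe_mapRingHom, map_poch, map_poch]
    simp [hσ]
  have H1 : (∑ a ∈ S, C ((f' a).comp (poch X (C (φ κ)) p)) *
      ((h' a).map σ).map (C : R →+* R[X])).comp (poch X (C (C (φ ν))) p) *
      (C (shiftSum φ (poch X (C (φ κ)) (p - 1))) *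
        (shiftSum φ (poch X (C (φ ν)) (p - 1))).map (C : R →+* R[X])) = 0 := by
    rw [← H, Polynomial.sum_comp, Finset.sum_mul]
    refine Finset.sum_congr rfl fun a _ => ?_
    rw [hf, hh, Polynomial.map_mul, Polynomial.map_mul, hpoch, map_comp, map_comp, hP, mul_comp,
      C_comp, C_mul]
    ring
  have hne : C (shiftSum φ (poch X (C (φ κ)) (p - 1))) *
      (shiftSum φ (poch X (C (φ ν)) (p - 1))).map (C : R →+* R[X]) ≠ 0 :=
    mul_ne_zero (C_ne_zero.2 (shiftSum_poch_pred_ne_zero φ κ))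
      ((Polynomial.map_ne_zero_iff C_injective).2 (shiftSum_poch_pred_ne_zero φ ν))
  have H2 := congrArg (fun g => coeff g m) (hcomp _ _ ((mul_eq_zero.1 H1).resolve_right hne))
  have H3 : (∑ a ∈ S, C (σ ((h' a).coeff m)) * f' a).comp (poch X (C (φ κ)) p) = 0 := by
    simp only [finsetSum_coeff, coeff_C_mul, coeff_map, coeff_zero] at H2
    rw [← H2, Polynomial.sum_comp]
    refine Finset.sum_congr rfl fun a _ => ?_
    rw [mul_comp, C_comp, mul_comm]
  have H4 := congrArg (fun g => coeff g l) (hcomp _ _ H3)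
  simpa only [finsetSum_coeff, coeff_C_mul, coeff_zero, hfc, hhc] using H4

end ShiftSum

/-! ### The telescoping identity. -/

section Telescoping

variable {ι B : Type*} [CommRing B]

/-- The telescoping identity behind the orthogonality relations; `x j` and `y j` are the values of
`t - z_j` and `u + z_j`. -/
theorem telescoping [Fintype ι] [LinearOrder ι] (x y : ι → B) (c w : B) (k k' : ℕ)
    (hk : (k : B) * c = 0 - 1 - c) (hk' : (k' : B) * c = 1 - c) (hw : ∀ j, x j + y j + 1 = w) :
    w * ∑ a, ((∏ j with j < a, poch (x j - c) c (k + 1)) * poch (x a - c) c k *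
        ∏ j with a < j, poch (x j) c (k + 1)) *
      ((∏ j with j < a, poch (y j + c) (-c) (k' + 1)) * poch (y a + c) (-c) k' *
        ∏ j with a < j, poch (y j) (-c) (k' + 1)) =
      (∏ j, poch (x j - c) c (k + 1)) * (∏ j, poch (y j + c) (-c) (k' + 1)) -
        (∏ j, poch (x j) c (k + 1)) * ∏ j, poch (y j) (-c) (k' + 1) := by
  -- After removing the common factors this is xy + (x + y + 1) = (x + 1)(y + 1): the last factors
  -- of the shifted products are x - c - kc = x + 1 and y + c + k'c = y + 1.
  have h (j : ι) : poch (x j) c (k + 1) * poch (y j) (-c) (k' + 1) +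
      w * (poch (x j - c) c k * poch (y j + c) (-c) k') =
      poch (x j - c) c (k + 1) * poch (y j + c) (-c) (k' + 1) := by
    rw [poch_succ_left (x j), poch_succ_left (y j), poch_succ_right (x j - c),
      poch_succ_right (y j + c), sub_neg_eq_add, mul_neg, hk, hk', ← hw j]
    ring
  -- Grouping the expansion by the largest index at which the second summand is chosen gives shifted
  -- factors below a and unshifted ones above a, as in Q_a.
  have key := Finset.prod_add_ordered Finset.univ
    (fun j => poch (x j) c (k + 1) * poch (y j) (-c) (k' + 1))
    (fun j => w * (poch (x j - c) c k * poch (y j + c) (-c) k'))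
  simp only [h] at key
  rw [← Finset.prod_mul_distrib, ← Finset.prod_mul_distrib, key, add_sub_cancel_left,
    Finset.mul_sum]
  refine Finset.sum_congr rfl fun a _ => ?_
  rw [Finset.prod_mul_distrib, Finset.prod_mul_distrib]
  ring

end Telescoping

/-- A function on pairs that is, up to a nonzero factor depending on the sum of the arguments only,
the difference of a function along the antidiagonals has vanishing total sum. -/
theorem sum_sum_eq_zero_of_antidiagonal {Z B : Type*} [AddCommGroup Z] [Fintype Z] [CommRing B]
    [IsDomain B] (w : Z → B) (hw : ∀ s, w s ≠ 0) (F G : Z → Z → B) (r : Z)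
    (h : ∀ s s', w (s + s') * F s s' = G (s - r) (s' + r) - G s s') :
    ∑ s, ∑ s', F s s' = 0 := by
  have h1 (s : Z) : ∑ s', F s s' = ∑ q, F s (q - s) :=
    Fintype.sum_equiv (Equiv.addRight s) _ _ fun s' => by simp
  simp only [h1]
  rw [Finset.sum_comm]
  refine Finset.sum_eq_zero fun q _ => ?_
  refine (mul_eq_zero.1 ?_).resolve_left (hw q)
  -- For fixed q = s + s' the terms are differences of one function of s at s - r and s, and s ↦ s -
  -- r permutes Z.
  have h2 (s : Z) : w q * F s (q - s) = G (s - r) (q - (s - r)) - G s (q - s) := by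
    rw [show q - (s - r) = q - s + r by abel, ← h s (q - s), add_sub_cancel]
  rw [Finset.mul_sum, Finset.sum_congr rfl fun s _ => h2 s, Finset.sum_sub_distrib, sub_eq_zero]
  exact Fintype.sum_equiv (Equiv.subRight r) _ _ fun s => by simp

/-! ### Orthogonality of the translated sums and the Shapovalov form. -/

section Orthogonality

variable {p : ℕ} [Fact p.Prime] (K : Type*) [Field K] [CharP K p] (n : ℕ)

/-- The prime field inside `K[z]`. -/
noncomputable def primeHom : ZMod p →+* MvPolynomial (Fin n) K :=
  MvPolynomial.C.comp (ZMod.castHom (dvd_refl p) K)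

variable {n}

theorem map_Qpoly {B : Type*} [CommRing B] (F : (MvPolynomial (Fin n) K)[X] →+* B)
    (κ : (ZMod p)ˣ) (a : Fin n) :
    F (Qpoly K κ a) =
      (∏ j with j < a,
        poch (F (tz K j) - F (C (step K n κ))) (F (C (step K n κ))) (kOf κ)) *
      poch (F (tz K a) - F (C (step K n κ))) (F (C (step K n κ))) (kOf κ - 1) *
      ∏ j with a < j, poch (F (tz K j)) (F (C (step K n κ))) (kOf κ) := by
  simp only [Qpoly, map_mul, map_prod, map_poch, map_sub]

/-- Orthogonality of the polynomials `Q_a(t, z; κ)` and `Q_a(u, -z; -κ)` summed over the translates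
of `t` and `u` by the prime field; `E s` and `E' s` evaluate at `t + s`, `z` and `u + s`, `-z`. -/
theorem sum_translates_Qpoly_eq_zero {B : Type*} [CommRing B] [IsDomain B] (κ : (ZMod p)ˣ)
    (E E' : ZMod p → (MvPolynomial (Fin n) K)[X] →+* B) (ψ : ZMod p →+* B) (t u : B)
    (ζ : Fin n → B) (hE : ∀ s j, E s (tz K j) = t + ψ s - ζ j)
    (hE' : ∀ s j, E' s (tz K j) = u + ψ s + ζ j)
    (hEc : ∀ s (ν : (ZMod p)ˣ), E s (C (step K n ν)) = ψ ν)
    (hEc' : ∀ s (ν : (ZMod p)ˣ), E' s (C (step K n ν)) = ψ ν)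
    (hne : ∀ q, t + u + ψ q + 1 ≠ 0) :
    ∑ s : ZMod p, ∑ s' : ZMod p,
      ∑ a : Fin n, E s (Qpoly K κ a) * E' s' (Qpoly K (-κ) a) = 0 := by
  -- Here k and k' are one less than k(κ) and k(-κ), matching the convention of `telescoping`.
  obtain ⟨k, hk⟩ := Nat.exists_eq_succ_of_ne_zero (kOf_spec κ).1.ne'
  obtain ⟨k', hk'⟩ := Nat.exists_eq_succ_of_ne_zero (kOf_spec (-κ)).1.ne'
  have hkc : (k : B) * ψ κ = 0 - 1 - ψ κ := by
    have h := congrArg ψ (kOf_spec κ).2.2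
    simp only [hk, Nat.succ_eq_add_one, map_mul, map_natCast, map_neg, map_one] at h
    push_cast at h
    linear_combination h
  have hkc' : (k' : B) * ψ κ = 1 - ψ κ := by
    have h := congrArg ψ (kOf_spec (-κ)).2.2
    simp only [hk', Nat.succ_eq_add_one, map_mul, map_natCast, map_neg, map_one,
      Units.val_neg] at h
    push_cast at h
    linear_combination -h
  refine sum_sum_eq_zero_of_antidiagonal (fun q => t + u + ψ q + 1) hne _
    (fun s s' => (∏ j, poch (E s (tz K j)) (ψ κ) (k + 1)) *
      ∏ j, poch (E' s' (tz K j)) (-ψ κ) (k' + 1)) (κ : ZMod p) fun s s' => ?_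
  have h := telescoping (fun j => E s (tz K j)) (fun j => E' s' (tz K j)) (ψ κ)
    (t + u + ψ (s + s') + 1) k k' hkc hkc' fun j => by
      rw [hE, hE', map_add]; ring
  have hshift (j : Fin n) : E (s - κ) (tz K j) = E s (tz K j) - ψ κ := by
    rw [hE, hE, map_sub]; ring
  have hshift' (j : Fin n) : E' (s' + κ) (tz K j) = E' s' (tz K j) + ψ κ := by
    rw [hE', hE', map_add]; ring
  simp only [hshift, hshift', ← h]
  congr 1
  refine Finset.sum_congr rfl fun a _ => ?_
  simp only [map_Qpoly, hEc, hEc', hk, hk', Nat.succ_eq_add_one, Units.val_neg, map_neg,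
    sub_neg_eq_add, add_tsub_cancel_right]

/-- This is the hypothesis of `sum_repr_mul_repr_eq_zero`, obtained by taking t and u to be
independent variables. -/
theorem sum_shiftSum_Qpoly_eq_zero (κ : (ZMod p)ˣ) :
    ∑ a : Fin n, C (shiftSum (primeHom K n) (Qpoly K κ a)) *
      ((shiftSum (primeHom K n) (Qpoly K (-κ) a)).map (negZ K n : _ →+* _)).map
        (C : MvPolynomial (Fin n) K →+* (MvPolynomial (Fin n) K)[X]) = 0 := by
  set φ : ZMod p →+* MvPolynomial (Fin n) K := primeHom K n with hφ
  let T (s : ZMod p) : (MvPolynomial (Fin n) K)[X] →+* (MvPolynomial (Fin n) K)[X] :=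
    (taylorAlgHom (φ s) : _ →ₐ[MvPolynomial (Fin n) K] _)
  have hσ (s : ZMod p) : negZ K n (φ s) = φ s := by simp [hφ, primeHom, negZ]
  have hσX (j : Fin n) : negZ K n (MvPolynomial.X j) = -MvPolynomial.X j := by simp [negZ]
  have hstep (ν : (ZMod p)ˣ) : step K n ν = φ ν := rfl
  -- In K[z][t][u], `E s` keeps t as the inner variable, while `E' s` negates z and makes the outer
  -- variable u the argument.
  let E (s : ZMod p) : (MvPolynomial (Fin n) K)[X] →+* (MvPolynomial (Fin n) K)[X][X] :=
    C.comp (T s)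
  let E' (s : ZMod p) : (MvPolynomial (Fin n) K)[X] →+* (MvPolynomial (Fin n) K)[X][X] :=
    ((mapRingHom C).comp (mapRingHom (negZ K n : _ →+* _))).comp (T s)
  have key := sum_translates_Qpoly_eq_zero (B := (MvPolynomial (Fin n) K)[X][X]) K κ E E'
    ((C.comp C).comp φ) (C X) X
    (fun j => C (C (MvPolynomial.X j)))
    (fun s j => by simp [E, T, tz]) (fun s j => by simp [E', T, tz, hσ, hσX])
    (fun s ν => by simp [E, T, hstep]) (fun s ν => by simp [E', T, hstep, hσ])
    -- The factor t + u + q + 1 has coefficient 1 at u.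
    (fun q h0 => by
      have := congrArg (fun g => coeff g 1) h0
      simp [coeff_one] at this)
  rw [← key]
  simp only [shiftSum_apply, map_sum, Polynomial.map_sum, Finset.sum_mul_sum]
  rw [Finset.sum_comm]
  refine Finset.sum_congr rfl fun s _ => ?_
  rw [Finset.sum_comm]
  rfl

/-- The Shapovalov form on the span of the vectors `v^{(a)}` is the standard dot product. -/
theorem shapovalov_sum_vOne {R : Type*} [CommRing R] (f g : Fin n → R) :
    shapovalov R n (∑ a, f a • vOne R n a) (∑ a, g a • vOne R n a) = ∑ a, f a * g a := by
  have hinj (a b : Fin n) :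
      ((fun j => if j = a then 1 else 0 : Fin n → Fin 2) = fun j => if j = b then 1 else 0) ↔
        a = b := by
    refine ⟨fun h => ?_, fun h => by rw [h]⟩
    by_contra hab
    simpa [hab] using congrFun h a
  simp only [map_sum, map_smul, LinearMap.sum_apply, LinearMap.smul_apply, vOne_eq_tensBasis,
    shapovalov, Module.Basis.toDual_apply, hinj, smul_eq_mul]
  simp
  exact Finset.sum_congr rfl fun a _ => mul_comm _ _

end Orthogonality

end QKZ

/-- Orthogonality of the `p`-hypergeometric solutions with steps `κ` and `-κ`, as an identity in
`K[z₁, …, zₙ]`. -/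
theorem theorem1p3 (p : ℕ) [Fact p.Prime] (K : Type*) [Field K] [CharP K p] (n : ℕ)
    (hpn : n < p) (κ : (ZMod p)ˣ) (hd0 : 0 < QKZ.dOf n κ) (hd1 : QKZ.dOf n κ < n - 1)
    (ℓ : ℕ) (hℓ : 1 ≤ ℓ ∧ ℓ ≤ QKZ.dOf n κ) (m : ℕ) (hm : 1 ≤ m ∧ m ≤ QKZ.dOf n (-κ)) :
    QKZ.shapovalov (MvPolynomial (Fin n) K) n
        (QKZ.QvecNeg K n (-κ) (m * p - 1)) (QKZ.Qvec K n κ (ℓ * p - 1)) =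
      ∑ a : Fin n, QKZ.negZ K n (QKZ.Qcoeff K (-κ) (m * p - 1) a) *
        QKZ.Qcoeff K κ (ℓ * p - 1) a ∧
    ∑ a : Fin n, QKZ.negZ K n (QKZ.Qcoeff K (-κ) (m * p - 1) a) *
        QKZ.Qcoeff K κ (ℓ * p - 1) a = 0 := by
  refine ⟨QKZ.shapovalov_sum_vOne _ _, ?_⟩
  have hp : 0 < p := (Fact.out : p.Prime).pos
  -- For l = 0 the truncated `l * p - 1` would be 0, not an index of the form -1 modulo p.
  have hindex (l : ℕ) (hl : 1 ≤ l) : l * p - 1 = (l - 1) * p + (p - 1) := by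
    obtain ⟨l, rfl⟩ := Nat.exists_eq_add_of_le' hl
    rw [add_tsub_cancel_right, add_mul, one_mul]
    omega
  rw [hindex ℓ hℓ.1, hindex m hm.1]
  exact QKZ.sum_repr_mul_repr_eq_zero (QKZ.primeHom K n) κ (-κ) (QKZ.negZ K n : _ →+* _)
    Finset.univ (QKZ.Qpoly K κ) (QKZ.Qpoly K (-κ)) (QKZ.sum_shiftSum_Qpoly_eq_zero K κ)
    (ℓ - 1) (m - 1)
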